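/- Let $b>0$, let $f=(f_1,\dots,f_m)^T$ be a vector of linearly independent, continuously differentiable real functions on $[0,b]$, each of bounded variation, with derivative $\dot f$, and consider the continuous time linear regression model $$Y_t=\theta^T f(t)+\varepsilon_t,\qquad t\in[0,b],$$ where $\theta\in\mathbb R^m$ is unknown, the full trajectory $(Y_t)_{t\in[0,b]}$ is observed, and $\varepsilon$ is a Brownian motion on $[0,b]$ (a centered Gaussian process with almost surely continuous paths and covariance kernel $\min(s,t)$). Suppose that the constant function $1$ is not in $\mathrm{span}\{f_1,\dots,f_m\}$ and that $f(0)\neq 0\in\mathbb R^m$. For $a\in[0,b)$ put $M_a=\int_a^b\dot f(s)\dot f^T(s)\,ds$ and, for $a>0$, $C_a=M_a+f(a)f^T(a)/a$. An estimator is a function of the observed trajectory. It is called linear if it is square integrable for every $\theta$ and there is a sequence, independent of $\theta$, of finite linear combinations $\sum_k Y_{t_k}w_k$ ($t_k\in[0,b]$, $w_k\in\mathbb R^m$) that converges to it in mean square under every $\theta$. It is a best linear unbiased estimator (BLUE) if it is linear and unbiased for every $\theta$ and, for every $\theta$, its covariance matrix is minimal in the Loewner ordering among all linear unbiased estimators.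 The stochastic integral $\int_0^b\dot f(t)\,dY_t$ is the mean square limit of the Riemann sums $\sum_k\dot f(t_k)(Y_{t_{k+1}}-Y_{t_k})$ over partitions $0=t_0\le\dots\le t_n=b$ as the mesh tends to $0$. Then $M_0$ is non-singular, $f^T(0)M_0^{-1}f(0)>0$, $C_a$ is non-singular for all sufficiently small $a>0$, and with $$\underline C=M_0^{-1}-\frac{M_0^{-1}f(0)f^T(0)M_0^{-1}}{f^T(0)M_0^{-1}f(0)}$$ one has $\lim_{a\downarrow 0}C_a^{-1}=\underline C$. The stochastic integral $\int_0^b\dot f(t)\,dY_t$ exists, as one function of the observed trajectory for all $\theta$, and $$\hat\theta_{\rm BLUE}=\underline C\int_0^b\dot f(t)\,dY_t+\frac{M_0^{-1}f(0)}{f^T(0)M_0^{-1}f(0)}\,Y_0$$ is the BLUE of $\theta$ (any other BLUE equals it almost surely, under every $\theta$); its covariance matrix is $\mathrm{Var}(\hat\theta_{\rm BLUE})=\underline C$ for every $\theta$. -/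

import Mathlib

open MeasureTheory ProbabilityTheory Filter Topology Set Matrix

noncomputable section

namespace ContinuousRegression

/-- The observation interval `[0,b]` as an index set. -/
abbrev Time (b : ℝ) : Type := Set.Icc (0 : ℝ) b

/-- A trajectory observed on `[0,b]`. -/
abbrev Path (b : ℝ) : Type := Time b → ℝ

/-- The left end point `0` of `[0,b]`. -/
def time0 {b : ℝ} (hb : 0 < b) : Time b := ⟨0, Set.left_mem_Icc.2 hb.le⟩

/-- Brownian motion on `[0,b]`: a centered Gaussian process with covariance kernel `min s t` and
almost surely continuous trajectories. -/
structure IsBrownianMotionOn {Ω : Type*} [MeasurableSpace Ω] (P : Measure Ω) {b : ℝ}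
    (ε : Time b → Ω → ℝ) : Prop where
  gaussian : IsGaussianProcess ε P
  centered : ∀ t, ∫ ω, ε t ω ∂P = 0
  covariance_eq : ∀ s t : Time b, cov[ε s, ε t; P] = min (s : ℝ) (t : ℝ)
  continuous_paths : ∀ᵐ ω ∂P, Continuous fun t : Time b => ε t ω

/-- The response trajectory `Y_t = θᵀ f(t) + ε_t`, `t ∈ [0,b]`, under the parameter `θ`. -/
def response {Ω : Type*} {b : ℝ} (ε : Time b → Ω → ℝ) {m : ℕ} (f : Fin m → ℝ → ℝ)
    (θ : Fin m → ℝ) (ω : Ω) : Path b :=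
  fun t => (∑ i, θ i * f i t) + ε t ω

/-- The Riemann sum `∑_{k<n} g(t_k) (z(t_{k+1}) - z(t_k))`. -/
def leftSum {b : ℝ} (g z : Path b) (n : ℕ) (t : ℕ → Time b) : ℝ :=
  ∑ k ∈ Finset.range n, g (t k) * (z (t (k + 1)) - z (t k))

/-- `X` is the stochastic integral `∫_0^b g(t) dZ_t` of a (continuous, deterministic) integrand `g`
against the process `Z`: it is square integrable and it is the mean square limit of the
Riemann sums over the partitions `0 = t_0 ≤ ⋯ ≤ t_n = b`, as the mesh tends to `0`. -/
def IsStochasticIntegral {Ω : Type*} [MeasurableSpace Ω] (P : Measure Ω) {b : ℝ}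
    (g : Path b) (Z : Ω → Path b) (X : Ω → ℝ) : Prop :=
  MemLp X 2 P ∧
  ∀ η : ℝ, 0 < η → ∃ δ : ℝ, 0 < δ ∧ ∀ (n : ℕ) (t : ℕ → Time b), Monotone t →
    (t 0 : ℝ) = 0 → (t n : ℝ) = b → (∀ k < n, (t (k + 1) : ℝ) - t k < δ) →
    eLpNorm (fun ω => X ω - leftSum g (Z ω) n t) 2 P ≤ ENNReal.ofReal η

/-- The derivative of `f_i` on `[0,b]` (one-sided at the end points). -/
def fdot (b : ℝ) {m : ℕ} (f : Fin m → ℝ → ℝ) (i : Fin m) (t : ℝ) : ℝ :=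
  derivWithin (f i) (Set.Icc 0 b) t

/-- The vector `f(t) = (f_1(t), …, f_m(t))ᵀ`. -/
def fvec {m : ℕ} (f : Fin m → ℝ → ℝ) (t : ℝ) : Fin m → ℝ := fun i => f i t

/-- `M_a = ∫_a^b ḟ(s) ḟ(s)ᵀ ds`. -/
def matM (b : ℝ) {m : ℕ} (f : Fin m → ℝ → ℝ) (a : ℝ) : Matrix (Fin m) (Fin m) ℝ :=
  Matrix.of fun i j => ∫ s in a..b, fdot b f i s * fdot b f j s

/-- `C_a = M_a + f(a) f(a)ᵀ / a`, for `a > 0`. -/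
def matC (b : ℝ) {m : ℕ} (f : Fin m → ℝ → ℝ) (a : ℝ) : Matrix (Fin m) (Fin m) ℝ :=
  matM b f a + a⁻¹ • Matrix.vecMulVec (fvec f a) (fvec f a)

/-- The number `f(0)ᵀ M_0⁻¹ f(0)`. -/
def quad0 (b : ℝ) {m : ℕ} (f : Fin m → ℝ → ℝ) : ℝ :=
  fvec f 0 ⬝ᵥ ((matM b f 0)⁻¹ *ᵥ fvec f 0)

/-- `M_0⁻¹ - M_0⁻¹ f(0) f(0)ᵀ M_0⁻¹ / (f(0)ᵀ M_0⁻¹ f(0))`. -/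
def lowerC (b : ℝ) {m : ℕ} (f : Fin m → ℝ → ℝ) : Matrix (Fin m) (Fin m) ℝ :=
  (matM b f 0)⁻¹ - (quad0 b f)⁻¹ •
    ((matM b f 0)⁻¹ * Matrix.vecMulVec (fvec f 0) (fvec f 0) * (matM b f 0)⁻¹)

/-- A linear estimator of `θ`: a functional `T` of the observed trajectory, the same for all `θ`,
which is under every `θ` the mean square limit of one sequence of finite linear combinations
`∑_t Y_t w_t` (finitely many `t ∈ [0,b]`, weights `w_t ∈ ℝ^m`) of the observations. -/
def IsLinearEstimator {Ω : Type*} [MeasurableSpace Ω] (P : Measure Ω) {b : ℝ}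
    (ε : Time b → Ω → ℝ) {m : ℕ} (f : Fin m → ℝ → ℝ) (T : Path b → Fin m → ℝ) : Prop :=
  (∀ (θ : Fin m → ℝ) (i : Fin m), MemLp (fun ω => T (response ε f θ ω) i) 2 P) ∧
  ∃ L : ℕ → (Time b →₀ (Fin m → ℝ)), ∀ (θ : Fin m → ℝ) (i : Fin m),
    Tendsto (fun n => eLpNorm (fun ω => T (response ε f θ ω) i -
      ((L n).sum fun t w => response ε f θ ω t • w) i) 2 P) atTop (𝓝 0)

/-- `T` is unbiased: `E_θ[T] = θ` for all `θ`. -/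
def IsUnbiased {Ω : Type*} [MeasurableSpace Ω] (P : Measure Ω) {b : ℝ}
    (ε : Time b → Ω → ℝ) {m : ℕ} (f : Fin m → ℝ → ℝ) (T : Path b → Fin m → ℝ) : Prop :=
  ∀ (θ : Fin m → ℝ) (i : Fin m), ∫ ω, T (response ε f θ ω) i ∂P = θ i

/-- The covariance matrix of the estimator `T` under the parameter `θ`. -/
def covMat {Ω : Type*} [MeasurableSpace Ω] (P : Measure Ω) {b : ℝ}
    (ε : Time b → Ω → ℝ) {m : ℕ} (f : Fin m → ℝ → ℝ) (T : Path b → Fin m → ℝ)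
    (θ : Fin m → ℝ) : Matrix (Fin m) (Fin m) ℝ :=
  Matrix.of fun i j =>
    cov[fun ω => T (response ε f θ ω) i, fun ω => T (response ε f θ ω) j; P]

/-- `T` is a best linear unbiased estimator: it is linear and unbiased and, under every `θ`, its
covariance matrix is minimal in the Loewner ordering among all linear unbiased estimators. -/
structure IsBLUE {Ω : Type*} [MeasurableSpace Ω] (P : Measure Ω) {b : ℝ}
    (ε : Time b → Ω → ℝ) {m : ℕ} (f : Fin m → ℝ → ℝ) (T : Path b → Fin m → ℝ) : Prop where
  linear : IsLinearEstimator P ε f T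
  unbiased : IsUnbiased P ε f T
  best : ∀ S : Path b → Fin m → ℝ, IsLinearEstimator P ε f S → IsUnbiased P ε f S →
    ∀ θ, (covMat P ε f S θ - covMat P ε f T θ).PosSemidef

/-- The functional `J` of the trajectory is (a version of) the vector `∫_0^b ḟ(t) dY_t`,
simultaneously under all parameters `θ`. -/
def IsIntegralFunctional {Ω : Type*} [MeasurableSpace Ω] (P : Measure Ω) {b : ℝ}
    (ε : Time b → Ω → ℝ) {m : ℕ} (f : Fin m → ℝ → ℝ) (J : Path b → Fin m → ℝ) : Prop :=
  ∀ (θ : Fin m → ℝ) (i : Fin m), IsStochasticIntegral P (fun t => fdot b f i t)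
    (response ε f θ) (fun ω => J (response ε f θ ω) i)

/-- The estimator `C ∫_0^b ḟ dY_t + (M_0⁻¹ f(0) / (f(0)ᵀ M_0⁻¹ f(0))) Y_0`, where `C` is `lowerC`
and `J` is a version of the stochastic integral. -/
def thetaHat {b : ℝ} (hb : 0 < b) {m : ℕ} (f : Fin m → ℝ → ℝ) (J : Path b → Fin m → ℝ) :
    Path b → Fin m → ℝ :=
  fun z => lowerC b f *ᵥ J z +
    z (time0 hb) • ((quad0 b f)⁻¹ • ((matM b f 0)⁻¹ *ᵥ fvec f 0))

end ContinuousRegression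

end

/-! Brownian motion and the indicators of `(0,t]` in L²(0,b] have the same Gram matrix `min s t`.
This gives an isometry from indicators to noise variables (`exists_transfer`). It carries `ḟ_i` to a
Wiener integral X_i whose covariance with `ε t` is ∫_0^t ḟ_i = `f i t - f i 0`, and it carries step
function approximation to convergence of Riemann sums.

Write C for `lowerC`. The matrix `M_0` is the Gram matrix of the `ḟ_i`. It is positive definite,
because a vanishing combination of the `ḟ_i` makes the same combination of the `f_i` constant. The
limit of `C_a⁻¹` follows from the Sherman–Morrison formula.

Since Y_0 carries no noise, `thetaHat` equals θ + C X almost surely (`thetaHat_ae_eq`). Optimality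
is an orthogonality argument. Let T be linear and unbiased, with approximating weights w independent
of θ. The covariance of the noise part of w with (C X)_j is the sum of w_t (C (f(t) - f(0)))_j. As C
f(0) = 0, this is the mean of w under the parameter equal to row j of C. Unbiasedness sends it to an
entry of C (`inner_errorL2_blueError`). Thus T has the same covariance with `thetaHat` whatever T
is, and Cov(T) - C is the Gram matrix of the difference of the errors. This gives minimality, and
also uniqueness, since a second BLUE forces that Gram matrix to vanish. -/

namespace ContinuousRegression

open scoped InnerProductSpace

/-! ### Isometric transfer between families with equal Gram matrices. -/

section Transfer

variable {ι H K : Type*} [NormedAddCommGroup H] [InnerProductSpace ℝ H]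
  [NormedAddCommGroup K] [InnerProductSpace ℝ K]

lemma inner_linearCombination_congr {v : ι → H} {e : ι → K}
    (h : ∀ s t, ⟪v s, v t⟫_ℝ = ⟪e s, e t⟫_ℝ) (w w' : ι →₀ ℝ) :
    ⟪Finsupp.linearCombination ℝ v w, Finsupp.linearCombination ℝ v w'⟫_ℝ =
      ⟪Finsupp.linearCombination ℝ e w, Finsupp.linearCombination ℝ e w'⟫_ℝ := by
  simp only [Finsupp.linearCombination_apply, Finsupp.sum, sum_inner, inner_sum,
    real_inner_smul_left, real_inner_smul_right, h]

lemma norm_linearCombination_congr {v : ι → H} {e : ι → K}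
    (h : ∀ s t, ⟪v s, v t⟫_ℝ = ⟪e s, e t⟫_ℝ) (w : ι →₀ ℝ) :
    ‖Finsupp.linearCombination ℝ v w‖ = ‖Finsupp.linearCombination ℝ e w‖ := by
  rw [norm_eq_sqrt_real_inner, norm_eq_sqrt_real_inner, inner_linearCombination_congr h]

/-- If two families have the same Gram matrix, a limit of linear combinations of the first one
has a counterpart for the second one. -/
lemma exists_transfer [CompleteSpace K] {v : ι → H} {e : ι → K}
    (h : ∀ s t, ⟪v s, v t⟫_ℝ = ⟪e s, e t⟫_ℝ) {γ : H} {w : ℕ → ι →₀ ℝ}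
    (hw : Tendsto (fun n => Finsupp.linearCombination ℝ v (w n)) atTop (𝓝 γ)) :
    ∃ X : K, (∀ u, ‖X - Finsupp.linearCombination ℝ e u‖ =
        ‖γ - Finsupp.linearCombination ℝ v u‖) ∧
      ∀ u, ⟪X, Finsupp.linearCombination ℝ e u⟫_ℝ =
        ⟪γ, Finsupp.linearCombination ℝ v u⟫_ℝ := by
  have hd : ∀ u u', ‖Finsupp.linearCombination ℝ e u - Finsupp.linearCombination ℝ e u'‖ =
      ‖Finsupp.linearCombination ℝ v u - Finsupp.linearCombination ℝ v u'‖ := fun u u' => by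
    rw [← map_sub, ← map_sub, norm_linearCombination_congr h]
  have hc : CauchySeq fun n => Finsupp.linearCombination ℝ e (w n) := by
    have := hw.cauchySeq
    rw [Metric.cauchySeq_iff] at this ⊢
    simpa only [dist_eq_norm, hd] using this
  obtain ⟨X, hX⟩ := cauchySeq_tendsto_of_complete hc
  refine ⟨X, fun u => ?_, fun u => ?_⟩
  · refine tendsto_nhds_unique (hX.sub_const _).norm ?_
    simpa only [hd] using (hw.sub_const (Finsupp.linearCombination ℝ v u)).norm
  · refine tendsto_nhds_unique (hX.inner (𝕜 := ℝ) tendsto_const_nhds) ?_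
    simpa only [inner_linearCombination_congr h] using
      hw.inner (𝕜 := ℝ) (tendsto_const_nhds (x := Finsupp.linearCombination ℝ v u))

end Transfer

lemma coeFn_linearCombination {ι α : Type*} [MeasurableSpace α] {μ : Measure α}
    {v : ι → Lp ℝ 2 μ} {F : ι → α → ℝ} (h : ∀ t, v t =ᵐ[μ] F t) (w : ι →₀ ℝ) :
    Finsupp.linearCombination ℝ v w =ᵐ[μ]
      fun x => Finsupp.linearCombination ℝ (fun t => F t x) w := by
  induction w using Finsupp.induction_linear with
  | zero =>
    simp only [map_zero]
    exact Lp.coeFn_zero ℝ 2 μ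
  | add u u' hu hu' =>
    rw [map_add]
    filter_upwards [hu, hu', Lp.coeFn_add (Finsupp.linearCombination ℝ v u)
      (Finsupp.linearCombination ℝ v u')] with x h1 h2 h3
    rw [h3, Pi.add_apply, h1, h2, map_add]
  | single t c =>
    rw [Finsupp.linearCombination_single]
    filter_upwards [h t, Lp.coeFn_smul c (v t)] with x h1 h2
    rw [h2, Pi.smul_apply, h1, Finsupp.linearCombination_single]

/-! ### Riemann sums as step functions in L²(0,b]. -/

section StepFunctions

variable {b : ℝ}

/-- The weights of a Riemann sum, as a finite linear combination of evaluations. -/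
noncomputable def partitionWeights (g : Path b) (n : ℕ) (t : ℕ → Time b) : Time b →₀ ℝ :=
  ∑ k ∈ Finset.range n, g (t k) • (Finsupp.single (t (k + 1)) 1 - Finsupp.single (t k) 1)

lemma leftSum_eq_linearCombination (g z : Path b) (n : ℕ) (t : ℕ → Time b) :
    leftSum g z n t = Finsupp.linearCombination ℝ z (partitionWeights g n t) := by
  simp [leftSum, partitionWeights, map_sum, map_sub]

/-- The partition of `[0,b]` into `N + 1` intervals of equal length. -/
noncomputable def uniformPartition (hb : 0 < b) (N k : ℕ) : Time b :=
  ⟨min (k * (b / (N + 1))) b, le_min (by positivity) hb.le, min_le_right _ _⟩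

lemma uniformPartition_monotone (hb : 0 < b) (N : ℕ) : Monotone (uniformPartition hb N) := by
  intro k l hkl
  refine Subtype.mk_le_mk.2 (min_le_min_right _ ?_)
  gcongr

lemma uniformPartition_zero (hb : 0 < b) (N : ℕ) : (uniformPartition hb N 0 : ℝ) = 0 := by
  simp [uniformPartition, hb.le]

lemma uniformPartition_last (hb : 0 < b) (N : ℕ) : (uniformPartition hb N (N + 1) : ℝ) = b := by
  have : ((N : ℝ) + 1) * (b / (N + 1)) = b := by field_simp
  simp [uniformPartition, this]

lemma uniformPartition_mesh (hb : 0 < b) (N k : ℕ) :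
    (uniformPartition hb N (k + 1) : ℝ) - uniformPartition hb N k ≤ b / (N + 1) := by
  have h0 : 0 < b / ((N : ℝ) + 1) := by positivity
  have : ((k + 1 : ℕ) : ℝ) * (b / (N + 1)) = k * (b / (N + 1)) + b / (N + 1) := by
    push_cast; ring
  simp only [uniformPartition, this]
  rcases min_cases ((k : ℝ) * (b / (N + 1))) b with h | h <;>
  rcases min_cases ((k : ℝ) * (b / (N + 1)) + b / (N + 1)) b with h' | h' <;> linarith

lemma eventually_uniformPartition_mesh (hb : 0 < b) {δ : ℝ} (hδ : 0 < δ) :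
    ∀ᶠ N in atTop, ∀ k < N + 1,
      (uniformPartition hb N (k + 1) : ℝ) - uniformPartition hb N k < δ := by
  have h : Tendsto (fun N : ℕ => b / ((N : ℝ) + 1)) atTop (𝓝 0) :=
    tendsto_const_nhds.div_atTop (tendsto_atTop_add_const_right _ _ tendsto_natCast_atTop_atTop)
  filter_upwards [h.eventually_lt_const hδ] with N hN k _
  exact (uniformPartition_mesh hb N k).trans_lt hN

/-- On `(0,b]` a Riemann sum against an indicator picks the value of the integrand at the left end
point of an interval of the partition. -/
lemma exists_leftSum_indicator_eq (g : Path b) {n : ℕ} {t : ℕ → Time b} (ht : Monotone t)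
    (h0 : (t 0 : ℝ) = 0) (hn : (t n : ℝ) = b) {x : ℝ} (hx : x ∈ Ioc 0 b) :
    ∃ k < n, (t k : ℝ) < x ∧ x ≤ t (k + 1) ∧
      leftSum g (fun s => (Ioc (0 : ℝ) s).indicator 1 x) n t = g (t k) := by
  classical
  -- The interval containing x ends at the first partition point not below x; that index is positive
  -- because `t 0 = 0 < x`.
  have hex : ∃ j, x ≤ t j := ⟨n, hx.2.trans_eq hn.symm⟩
  obtain ⟨k, hk⟩ : ∃ k, Nat.find hex = k + 1 := by
    refine Nat.exists_eq_succ_of_ne_zero fun h => ?_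
    have := Nat.find_spec hex
    rw [h, h0] at this
    exact absurd hx.1 this.not_gt
  have hk1 : x ≤ t (k + 1) := hk ▸ Nat.find_spec hex
  have hk2 : (t k : ℝ) < x := not_le.1 (Nat.find_min hex (m := k) (by omega))
  have hkn : k < n := by
    by_contra! h
    have : (t n : ℝ) ≤ t k := ht h
    have := hx.2
    linarith
  have hlo : ∀ j ≤ k, (Ioc (0 : ℝ) (t j)).indicator (1 : ℝ → ℝ) x = 0 := fun j hj => by
    have : (t j : ℝ) ≤ t k := ht hj
    exact indicator_of_notMem (fun h => absurd h.2 (not_le.2 (by linarith))) _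
  have hhi : ∀ j, k + 1 ≤ j → (Ioc (0 : ℝ) (t j)).indicator (1 : ℝ → ℝ) x = 1 := fun j hj => by
    have : (t (k + 1) : ℝ) ≤ t j := ht hj
    exact indicator_of_mem (s := Ioc (0 : ℝ) (t j)) ⟨hx.1, by linarith⟩ _
  refine ⟨k, hkn, hk2, hk1, ?_⟩
  rw [leftSum, Finset.sum_eq_single k]
  · simp [hlo k le_rfl, hhi (k + 1) le_rfl]
  · intro j _ hj
    rcases lt_or_gt_of_ne hj with h | h
    · simp [hlo j h.le, hlo (j + 1) h]
    · simp [hhi j h, hhi (j + 1) (by omega)]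
  · intro h
    exact absurd (Finset.mem_range.2 hkn) h

/-- Lebesgue measure on `(0,b]`. -/
noncomputable abbrev timeMeasure (b : ℝ) : Measure ℝ := volume.restrict (Ioc 0 b)

/-- The indicator of `(0,t]` as a square integrable function. -/
noncomputable def initialIndicator (t : Time b) : Lp ℝ 2 (timeMeasure b) :=
  indicatorConstLp 2 (measurableSet_Ioc (a := (0 : ℝ)) (b := (t : ℝ))) (measure_ne_top _ _) 1

lemma coeFn_initialIndicator (t : Time b) :
    initialIndicator t =ᵐ[timeMeasure b] (Ioc (0 : ℝ) t).indicator 1 :=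
  indicatorConstLp_coeFn

lemma inner_initialIndicator (s t : Time b) :
    ⟪initialIndicator s, initialIndicator t⟫_ℝ = min (s : ℝ) t := by
  have h : Ioc (0 : ℝ) s ∩ Ioc 0 t ∩ Ioc 0 b = Ioc 0 (min (s : ℝ) t) := by
    rw [Ioc_inter_Ioc, Ioc_inter_Ioc, sup_idem, sup_idem,
      inf_eq_left.2 (inf_le_left.trans s.2.2 : (s : ℝ) ⊓ t ≤ b)]
  rw [initialIndicator, initialIndicator,
    L2.real_inner_indicatorConstLp_one_indicatorConstLp_one, measureReal_restrict_apply
      (measurableSet_Ioc.inter measurableSet_Ioc), h, Real.volume_real_Ioc_of_le, sub_zero]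
  exact le_min s.2.1 t.2.1

lemma memLp_timeMeasure {g : ℝ → ℝ} (hg : ContinuousOn g (Icc 0 b)) :
    MemLp g 2 (timeMeasure b) := by
  obtain ⟨C, hC⟩ := isCompact_Icc.exists_bound_of_continuousOn hg
  refine MemLp.of_bound ((hg.mono Ioc_subset_Icc_self).aestronglyMeasurable measurableSet_Ioc) C ?_
  exact (ae_restrict_mem measurableSet_Ioc).mono fun x hx => hC x (Ioc_subset_Icc_self hx)

lemma inner_initialIndicator_toLp {g : ℝ → ℝ} (hg : MemLp g 2 (timeMeasure b)) (t : Time b) :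
    ⟪initialIndicator t, hg.toLp g⟫_ℝ = ∫ s in (0 : ℝ)..t, g s := by
  rw [initialIndicator, L2.inner_indicatorConstLp_one, intervalIntegral.integral_of_le t.2.1,
    Measure.restrict_restrict measurableSet_Ioc,
    inter_eq_left.2 (Ioc_subset_Ioc_right t.2.2)]
  refine integral_congr_ae ?_
  exact ae_restrict_of_ae_restrict_of_subset (Ioc_subset_Ioc_right t.2.2) hg.coeFn_toLp

lemma inner_toLp_toLp (hb : 0 < b) {g h : ℝ → ℝ} (hg : MemLp g 2 (timeMeasure b))
    (hh : MemLp h 2 (timeMeasure b)) :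
    ⟪hg.toLp g, hh.toLp h⟫_ℝ = ∫ s in (0 : ℝ)..b, g s * h s := by
  rw [L2.inner_def, intervalIntegral.integral_of_le hb.le]
  refine integral_congr_ae ?_
  filter_upwards [hg.coeFn_toLp, hh.coeFn_toLp] with x h1 h2
  rw [h1, h2, real_inner_eq_re_inner]
  simp [mul_comm]

/-- Step functions of fine partitions approximate a continuous function in mean square. -/
lemma exists_mesh_norm_sub_le {g : ℝ → ℝ} (hg : ContinuousOn g (Icc 0 b)) {η : ℝ} (hη : 0 < η) :
    ∃ δ : ℝ, 0 < δ ∧ ∀ (n : ℕ) (t : ℕ → Time b), Monotone t → (t 0 : ℝ) = 0 → (t n : ℝ) = b →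
      (∀ k < n, (t (k + 1) : ℝ) - t k < δ) →
      ‖(memLp_timeMeasure hg).toLp g - Finsupp.linearCombination ℝ initialIndicator
        (partitionWeights (fun s => g s) n t)‖ ≤ η := by
  set c : ℝ := (measureUnivNNReal (timeMeasure b) : ℝ) ^ (2 : ENNReal).toReal⁻¹ with hc
  have hc0 : 0 ≤ c := by positivity
  have huc := isCompact_Icc.uniformContinuousOn_of_continuous hg
  rw [Metric.uniformContinuousOn_iff] at huc
  -- Here c is the square root of the total mass, so a uniform error η/(c+1) costs at most cη/(c+1)
  -- ≤ η in L². The added 1 keeps the divisor positive.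
  obtain ⟨δ, hδ, hgδ⟩ := huc (η / (c + 1)) (by positivity)
  refine ⟨δ, hδ, fun n t ht h0 hn hmesh => ?_⟩
  have key : ∀ᵐ x ∂timeMeasure b, ‖((memLp_timeMeasure hg).toLp g -
      Finsupp.linearCombination ℝ initialIndicator (partitionWeights (fun s => g s) n t) :
        Lp ℝ 2 (timeMeasure b)) x‖ ≤ η / (c + 1) := by
    filter_upwards [Lp.coeFn_sub ((memLp_timeMeasure hg).toLp g)
        (Finsupp.linearCombination ℝ initialIndicator (partitionWeights (fun s => g s) n t)),
      (memLp_timeMeasure hg).coeFn_toLp, ae_restrict_mem measurableSet_Ioc,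
      coeFn_linearCombination coeFn_initialIndicator (partitionWeights (fun s => g s) n t)]
      with x h1 h2 hx h3
    obtain ⟨k, hk, hk1, hk2, hs⟩ := exists_leftSum_indicator_eq (fun s => g s) ht h0 hn hx
    rw [h1, Pi.sub_apply, h2, h3, ← leftSum_eq_linearCombination, hs, ← dist_eq_norm]
    refine (hgδ x (Ioc_subset_Icc_self hx) (t k) (t k).2 ?_).le
    rw [Real.dist_eq, abs_of_pos (by linarith)]
    linarith [hmesh k hk]
  refine (Lp.norm_le_of_ae_bound (by positivity) key).trans ?_
  rw [← hc, mul_div_assoc', div_le_iff₀ (by positivity)]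
  nlinarith

lemma tendsto_linearCombination_uniformPartition (hb : 0 < b) {g : ℝ → ℝ}
    (hg : ContinuousOn g (Icc 0 b)) :
    Tendsto (fun N => Finsupp.linearCombination ℝ initialIndicator
        (partitionWeights (fun s => g s) (N + 1) (uniformPartition hb N))) atTop
      (𝓝 ((memLp_timeMeasure hg).toLp g)) := by
  rw [Metric.tendsto_atTop']
  intro η hη
  obtain ⟨δ, hδ, h⟩ := exists_mesh_norm_sub_le hg (half_pos hη)
  obtain ⟨N₀, hN₀⟩ := eventually_atTop.1 (eventually_uniformPartition_mesh hb hδ)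
  refine ⟨N₀, fun N hN => ?_⟩
  rw [dist_comm, dist_eq_norm]
  exact (h _ _ (uniformPartition_monotone hb N) (uniformPartition_zero hb N)
    (by exact_mod_cast uniformPartition_last hb N) (hN₀ N hN.le)).trans_lt (half_lt_self hη)

end StepFunctions

/-! ### Rank one updates and continuity of the matrix inverse. -/

section RankOne

variable {m : ℕ}

lemma mul_vecMulVec_mul_self (A : Matrix (Fin m) (Fin m) ℝ) (u : Fin m → ℝ) :
    vecMulVec u u * A * vecMulVec u u = (u ⬝ᵥ (A *ᵥ u)) • vecMulVec u u := by
  rw [Matrix.mul_assoc, mul_vecMulVec, vecMulVec_mul_vecMulVec, vecMulVec_smul]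

/-- The Sherman–Morrison formula. -/
lemma add_inv_smul_vecMulVec_mul {M : Matrix (Fin m) (Fin m) ℝ} (hM : IsUnit M) (u : Fin m → ℝ)
    {a : ℝ} (ha : a ≠ 0) (haq : a + u ⬝ᵥ (M⁻¹ *ᵥ u) ≠ 0) :
    (M + a⁻¹ • vecMulVec u u) *
      (M⁻¹ - (a + u ⬝ᵥ (M⁻¹ *ᵥ u))⁻¹ • (M⁻¹ * vecMulVec u u * M⁻¹)) = 1 := by
  have hdet := (Matrix.isUnit_iff_isUnit_det M).1 hM
  have h1 : M * M⁻¹ = 1 := Matrix.mul_nonsing_inv M hdet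
  have h2 : M * (M⁻¹ * vecMulVec u u * M⁻¹) = vecMulVec u u * M⁻¹ := by
    rw [← Matrix.mul_assoc, ← Matrix.mul_assoc, h1, Matrix.one_mul]
  have h3 : vecMulVec u u * (M⁻¹ * vecMulVec u u * M⁻¹) =
      (u ⬝ᵥ (M⁻¹ *ᵥ u)) • (vecMulVec u u * M⁻¹) := by
    rw [← Matrix.mul_assoc, ← Matrix.mul_assoc, mul_vecMulVec_mul_self, Matrix.smul_mul]
  rw [Matrix.mul_sub, Matrix.add_mul, Matrix.add_mul, h1, Matrix.mul_smul, Matrix.mul_smul, h2,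
    Matrix.smul_mul, Matrix.smul_mul, h3, smul_smul, smul_smul]
  have : (a + u ⬝ᵥ (M⁻¹ *ᵥ u))⁻¹ + (a + u ⬝ᵥ (M⁻¹ *ᵥ u))⁻¹ * a⁻¹ * u ⬝ᵥ (M⁻¹ *ᵥ u) = a⁻¹ := by
    field_simp
  rw [← add_smul, this, add_sub_cancel_right]

lemma tendsto_matrix_inv {α : Type*} {l : Filter α} {A : α → Matrix (Fin m) (Fin m) ℝ}
    {B : Matrix (Fin m) (Fin m) ℝ} (hA : Tendsto A l (𝓝 B)) (hB : IsUnit B) :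
    Tendsto (fun x => (A x)⁻¹) l (𝓝 B⁻¹) := by
  have hdet : B.det ≠ 0 := ((Matrix.isUnit_iff_isUnit_det B).1 hB).ne_zero
  simp only [Matrix.inv_def, Ring.inverse_eq_inv']
  exact (((Continuous.matrix_det continuous_id).tendsto B).comp hA).inv₀ hdet |>.smul
    (((Continuous.matrix_adjugate continuous_id).tendsto B).comp hA)

end RankOne

/-! ### The matrices `M_a`, `C_a` and the limit of `C_a⁻¹`. -/

section InformationMatrix

variable {b : ℝ} {m : ℕ} {f : Fin m → ℝ → ℝ}

lemma continuousOn_fdot (hb : 0 < b) (hf : ∀ i, ContDiffOn ℝ 1 (f i) (Icc 0 b)) (i : Fin m) :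
    ContinuousOn (fdot b f i) (Icc 0 b) :=
  (hf i).continuousOn_derivWithin (uniqueDiffOn_Icc hb) le_rfl

lemma integral_fdot (hb : 0 < b) (hf : ∀ i, ContDiffOn ℝ 1 (f i) (Icc 0 b)) (i : Fin m)
    (t : Time b) : ∫ s in (0 : ℝ)..t, fdot b f i s = f i t - f i 0 := by
  have hsub : Icc (0 : ℝ) t ⊆ Icc 0 b := Icc_subset_Icc_right t.2.2
  refine intervalIntegral.integral_eq_sub_of_hasDerivAt_of_le t.2.1
    ((hf i).continuousOn.mono hsub) (fun x hx => ?_) ?_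
  · have hx' : x ∈ Ioo (0 : ℝ) b := ⟨hx.1, hx.2.trans_le t.2.2⟩
    exact (((hf i).differentiableOn one_ne_zero) x (Ioo_subset_Icc_self hx')).hasDerivWithinAt.hasDerivAt
      (Icc_mem_nhds hx'.1 hx'.2)
  · exact ((continuousOn_fdot hb hf i).mono hsub).intervalIntegrable_of_Icc t.2.1

/-- The derivative of `f_i` as a square integrable function. -/
noncomputable def fdotL2 (hb : 0 < b) (hf : ∀ i, ContDiffOn ℝ 1 (f i) (Icc 0 b)) (i : Fin m) :
    Lp ℝ 2 (timeMeasure b) :=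
  (memLp_timeMeasure (continuousOn_fdot hb hf i)).toLp (fdot b f i)

lemma inner_initialIndicator_fdotL2 (hb : 0 < b) (hf : ∀ i, ContDiffOn ℝ 1 (f i) (Icc 0 b))
    (i : Fin m) (t : Time b) : ⟪initialIndicator t, fdotL2 hb hf i⟫_ℝ = f i t - f i 0 := by
  rw [fdotL2, inner_initialIndicator_toLp, integral_fdot hb hf]

lemma inner_fdotL2 (hb : 0 < b) (hf : ∀ i, ContDiffOn ℝ 1 (f i) (Icc 0 b)) (i j : Fin m) :
    ⟪fdotL2 hb hf i, fdotL2 hb hf j⟫_ℝ = matM b f 0 i j :=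
  inner_toLp_toLp hb _ _

lemma gram_fdotL2 (hb : 0 < b) (hf : ∀ i, ContDiffOn ℝ 1 (f i) (Icc 0 b)) :
    Matrix.gram ℝ (fdotL2 hb hf) = matM b f 0 := by
  ext i j
  exact inner_fdotL2 hb hf i j

/-- Pairing a vanishing combination of derivatives with the indicator of `(0,t]` shows that the same
combination of the `f_i` is constant. A nonzero constant would put 1 in the span, so the constant is
0 and independence of the `f_i` applies. -/
lemma linearIndependent_fdotL2 (hb : 0 < b) (hf : ∀ i, ContDiffOn ℝ 1 (f i) (Icc 0 b))
    (hli : LinearIndependent ℝ fun i => fun t : Icc (0 : ℝ) b => f i t)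
    (hone : (fun _ : Icc (0 : ℝ) b => (1 : ℝ)) ∉
      Submodule.span ℝ (range fun i => fun t : Icc (0 : ℝ) b => f i t)) :
    LinearIndependent ℝ (fdotL2 hb hf) := by
  rw [Fintype.linearIndependent_iff] at hli ⊢
  intro c hc
  have hconst : ∀ t : Time b, ∑ i, c i * f i t = ∑ i, c i * f i 0 := fun t => by
    have : ⟪initialIndicator t, ∑ i, c i • fdotL2 hb hf i⟫_ℝ = 0 := by rw [hc, inner_zero_right]
    simp only [inner_sum, real_inner_smul_right, inner_initialIndicator_fdotL2, mul_sub,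
      Finset.sum_sub_distrib] at this
    linarith
  have h0 : ∑ i, c i * f i 0 = 0 := by
    by_contra hne
    refine hone ?_
    have : (fun _ : Icc (0 : ℝ) b => (1 : ℝ)) =
        (∑ i, c i * f i 0)⁻¹ • ∑ i, c i • fun t : Icc (0 : ℝ) b => f i t := by
      ext t
      simp [hconst t, inv_mul_cancel₀ hne]
    rw [this]
    exact Submodule.smul_mem _ _ (Submodule.sum_mem _ fun i _ =>
      Submodule.smul_mem _ _ (Submodule.subset_span ⟨i, rfl⟩))
  refine hli c ?_
  ext t
  simp [hconst t, h0]

lemma posDef_matM (hb : 0 < b) (hf : ∀ i, ContDiffOn ℝ 1 (f i) (Icc 0 b))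
    (hli : LinearIndependent ℝ fun i => fun t : Icc (0 : ℝ) b => f i t)
    (hone : (fun _ : Icc (0 : ℝ) b => (1 : ℝ)) ∉
      Submodule.span ℝ (range fun i => fun t : Icc (0 : ℝ) b => f i t)) :
    (matM b f 0).PosDef := by
  rw [← gram_fdotL2 hb hf]
  exact Matrix.posDef_gram_of_linearIndependent (linearIndependent_fdotL2 hb hf hli hone)

lemma quad0_pos (hM : (matM b f 0).PosDef) (hf0 : fvec f 0 ≠ 0) : 0 < quad0 b f := by
  have := hM.inv.dotProduct_mulVec_pos hf0
  rwa [star_trivial] at this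

lemma tendsto_matM (hb : 0 < b) (hf : ∀ i, ContDiffOn ℝ 1 (f i) (Icc 0 b)) :
    Tendsto (matM b f) (𝓝[>] 0) (𝓝 (matM b f 0)) := by
  refine tendsto_pi_nhds.2 fun i => tendsto_pi_nhds.2 fun j => ?_
  have hc : ContinuousOn (fun s => fdot b f i s * fdot b f j s) (Icc 0 b) :=
    (continuousOn_fdot hb hf i).mul (continuousOn_fdot hb hf j)
  have := intervalIntegral.continuousOn_primitive_interval_left (a := 0) (b := b) (μ := volume)
    (by rw [uIcc_of_le hb.le]; exact hc.integrableOn_Icc)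
  rw [uIcc_of_le hb.le] at this
  refine (this 0 (left_mem_Icc.2 hb.le)).mono_left ?_
  rw [← nhdsWithin_Ioc_eq_nhdsGT hb]
  exact nhdsWithin_mono _ Ioc_subset_Icc_self

lemma tendsto_fvec (hb : 0 < b) (hf : ∀ i, ContDiffOn ℝ 1 (f i) (Icc 0 b)) :
    Tendsto (fvec f) (𝓝[>] 0) (𝓝 (fvec f 0)) := by
  refine tendsto_pi_nhds.2 fun i => ((hf i).continuousOn 0 (left_mem_Icc.2 hb.le)).mono_left ?_
  rw [← nhdsWithin_Ioc_eq_nhdsGT hb]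
  exact nhdsWithin_mono _ Ioc_subset_Icc_self

/-- `C_a` is invertible for small `a > 0`, and `C_a⁻¹` converges. -/
lemma isUnit_matC_and_tendsto_inv (hb : 0 < b) (hf : ∀ i, ContDiffOn ℝ 1 (f i) (Icc 0 b))
    (hM : IsUnit (matM b f 0)) (hq : 0 < quad0 b f) :
    (∀ᶠ a in 𝓝[>] (0 : ℝ), IsUnit (matC b f a)) ∧
      Tendsto (fun a => (matC b f a)⁻¹) (𝓝[>] (0 : ℝ)) (𝓝 (lowerC b f)) := by
  have hMt := tendsto_matM hb hf
  have hft := tendsto_fvec hb hf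
  have hMi := tendsto_matrix_inv hMt hM
  have hqt : Tendsto (fun a => a + fvec f a ⬝ᵥ ((matM b f a)⁻¹ *ᵥ fvec f a)) (𝓝[>] 0)
      (𝓝 (quad0 b f)) := by
    have hcont : Continuous fun p : ℝ × (Fin m → ℝ) × Matrix (Fin m) (Fin m) ℝ =>
        p.1 + p.2.1 ⬝ᵥ (p.2.2 *ᵥ p.2.1) := by fun_prop
    have h0 : Tendsto (fun a : ℝ => a) (𝓝[>] 0) (𝓝 0) := nhdsWithin_le_nhds
    have := (hcont.tendsto _).comp (h0.prodMk_nhds (hft.prodMk_nhds hMi))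
    simpa [quad0, Function.comp_def] using this
  have hunit : ∀ᶠ a in 𝓝[>] (0 : ℝ), IsUnit (matM b f a) := by
    have hdet : (matM b f 0).det ≠ 0 := ((Matrix.isUnit_iff_isUnit_det _).1 hM).ne_zero
    have := (((Continuous.matrix_det continuous_id).tendsto (matM b f 0)).comp hMt).eventually_ne
      hdet
    filter_upwards [this] with a ha
    exact (Matrix.isUnit_iff_isUnit_det _).2 (isUnit_iff_ne_zero.2 ha)
  -- In Sherman–Morrison form the singular factor `a⁻¹` is absorbed into a denominator that tends to
  -- `quad0`, which is positive, so the limit can be taken termwise.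
  have key : ∀ᶠ a in 𝓝[>] (0 : ℝ), matC b f a * ((matM b f a)⁻¹ -
      (a + fvec f a ⬝ᵥ ((matM b f a)⁻¹ *ᵥ fvec f a))⁻¹ •
        ((matM b f a)⁻¹ * vecMulVec (fvec f a) (fvec f a) * (matM b f a)⁻¹)) = 1 := by
    filter_upwards [hunit, hqt.eventually_ne hq.ne', self_mem_nhdsWithin] with a h1 h2 h3
    exact add_inv_smul_vecMulVec_mul h1 _ (ne_of_gt h3) h2
  refine ⟨key.mono fun a ha => .of_mul_eq_one _ ha, ?_⟩
  refine Tendsto.congr' (key.mono fun a ha => (Matrix.inv_eq_right_inv ha).symm) ?_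
  have hV : Tendsto (fun a => vecMulVec (fvec f a) (fvec f a)) (𝓝[>] 0)
      (𝓝 (vecMulVec (fvec f 0) (fvec f 0))) := by
    have hcont : Continuous fun u : Fin m → ℝ => vecMulVec u u := by fun_prop
    exact (hcont.tendsto _).comp hft
  exact hMi.sub ((hqt.inv₀ hq.ne').smul ((hMi.mul hV).mul hMi))

/-- The correction term sends `f(0)` to `M_0⁻¹ f(0)`, since one factor `quad0` cancels. This is what
later removes `f(0)` from the covariances of the Wiener integrals. -/
lemma lowerC_mulVec_fvec (hq : quad0 b f ≠ 0) : lowerC b f *ᵥ fvec f 0 = 0 := by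
  rw [lowerC, sub_mulVec, smul_mulVec, Matrix.mul_assoc, ← mulVec_mulVec, ← mulVec_mulVec,
    vecMulVec_mulVec]
  change _ - (quad0 b f)⁻¹ • (matM b f 0)⁻¹ *ᵥ (MulOpposite.op (quad0 b f) • fvec f 0) = 0
  rw [op_smul_eq_smul, mulVec_smul, smul_smul, inv_mul_cancel₀ hq, one_smul, sub_self]

/-- The estimator reproduces the parameter when applied to the mean of the response. -/
lemma lowerC_mulVec_matM_mulVec_add (hM : IsUnit (matM b f 0)) (θ : Fin m → ℝ) :
    lowerC b f *ᵥ (matM b f 0 *ᵥ θ) +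
      (θ ⬝ᵥ fvec f 0) • ((quad0 b f)⁻¹ • ((matM b f 0)⁻¹ *ᵥ fvec f 0)) = θ := by
  have h1 : (matM b f 0)⁻¹ * matM b f 0 = 1 :=
    Matrix.nonsing_inv_mul _ ((Matrix.isUnit_iff_isUnit_det _).1 hM)
  rw [mulVec_mulVec, lowerC, Matrix.sub_mul, Matrix.smul_mul, Matrix.mul_assoc _ _ (matM b f 0),
    h1, Matrix.mul_one, sub_mulVec, one_mulVec, smul_mulVec, ← mulVec_mulVec, vecMulVec_mulVec,
    op_smul_eq_smul, mulVec_smul, dotProduct_comm θ, smul_comm, sub_add_cancel]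

end InformationMatrix

/-! ### Observations as elements of L²(P). -/

section Response

variable {Ω : Type*} [MeasurableSpace Ω] {P : Measure Ω} [IsProbabilityMeasure P]
  {b : ℝ} {ε : Time b → Ω → ℝ} {m : ℕ} {f : Fin m → ℝ → ℝ}

omit [IsProbabilityMeasure P] in
lemma IsBrownianMotionOn.memLp (hε : IsBrownianMotionOn P ε) (t : Time b) : MemLp (ε t) 2 P :=
  (hε.gaussian.hasGaussianLaw_eval t).memLp_two

/-- The value at time `t` of the noise, as a square integrable random variable. -/
noncomputable def noiseL2 (hε : IsBrownianMotionOn P ε) (t : Time b) : Lp ℝ 2 P :=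
  (hε.memLp t).toLp (ε t)

omit [IsProbabilityMeasure P] in
lemma inner_noiseL2 (hε : IsBrownianMotionOn P ε) (s t : Time b) :
    ⟪noiseL2 hε s, noiseL2 hε t⟫_ℝ = min (s : ℝ) t := by
  rw [← hε.covariance_eq s t, covariance, L2.inner_def]
  refine integral_congr_ae ?_
  filter_upwards [(hε.memLp s).coeFn_toLp, (hε.memLp t).coeFn_toLp] with ω h1 h2
  simp [noiseL2, h1, h2, hε.centered, mul_comm]

/-- Writing the expectation as an inner product lets it pass to L² limits. -/
lemma inner_const_one (F : Lp ℝ 2 P) : ⟪Lp.const 2 P (1 : ℝ), F⟫_ℝ = ∫ ω, F ω ∂P := by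
  rw [L2.inner_def]
  exact integral_congr_ae (.of_forall fun ω => by simp)

lemma inner_const_one_const (c : ℝ) : ⟪Lp.const 2 P (1 : ℝ), Lp.const 2 P c⟫_ℝ = c := by
  rw [inner_const_one, integral_congr_ae (Lp.coeFn_const (p := 2) (μ := P) (c := c))]
  simp

lemma inner_const_one_noiseL2 (hε : IsBrownianMotionOn P ε) (w : Time b →₀ ℝ) :
    ⟪Lp.const 2 P (1 : ℝ), Finsupp.linearCombination ℝ (noiseL2 hε) w⟫_ℝ = 0 := by
  have h : ∀ t, ⟪Lp.const 2 P (1 : ℝ), noiseL2 hε t⟫_ℝ = 0 := fun t => by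
    rw [inner_const_one, noiseL2, integral_congr_ae (hε.memLp t).coeFn_toLp, hε.centered]
  simp [Finsupp.linearCombination_apply, Finsupp.sum, inner_sum, real_inner_smul_right, h]

lemma norm_const (c : ℝ) : ‖Lp.const 2 P c‖ = |c| := by
  rw [Lp.norm_const'] <;> simp

lemma tendsto_const {α : Type*} {l : Filter α} {u : α → ℝ} {c : ℝ} (h : Tendsto u l (𝓝 c)) :
    Tendsto (fun x => Lp.const 2 P (u x)) l (𝓝 (Lp.const 2 P c)) :=
  ((Lp.constL 2 P ℝ (E := ℝ)).continuous.tendsto c).comp h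

/-- The mean of the response trajectory. -/
def meanPath (b : ℝ) (f : Fin m → ℝ → ℝ) (θ : Fin m → ℝ) : Path b := fun t => ∑ i, θ i * f i t

omit [MeasurableSpace Ω] in
lemma linearCombination_response (θ : Fin m → ℝ) (ω : Ω) (w : Time b →₀ ℝ) :
    Finsupp.linearCombination ℝ (response ε f θ ω) w =
      Finsupp.linearCombination ℝ (meanPath b f θ) w +
        Finsupp.linearCombination ℝ (fun t => ε t ω) w := by
  simp [Finsupp.linearCombination_apply, response, meanPath, mul_add, Finsupp.sum_add]

/-- A finite linear combination of observations, as a square integrable random variable. -/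
noncomputable def observationL2 (hε : IsBrownianMotionOn P ε) (f : Fin m → ℝ → ℝ) (θ : Fin m → ℝ)
    (w : Time b →₀ ℝ) : Lp ℝ 2 P :=
  Lp.const 2 P (Finsupp.linearCombination ℝ (meanPath b f θ) w) +
    Finsupp.linearCombination ℝ (noiseL2 hε) w

lemma coeFn_observationL2 (hε : IsBrownianMotionOn P ε) (θ : Fin m → ℝ) (w : Time b →₀ ℝ) :
    observationL2 hε f θ w =ᵐ[P]
      fun ω => Finsupp.linearCombination ℝ (response ε f θ ω) w := by
  filter_upwards [Lp.coeFn_add (Lp.const 2 P (Finsupp.linearCombination ℝ (meanPath b f θ) w))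
      (Finsupp.linearCombination ℝ (noiseL2 hε) w),
    Lp.coeFn_const (p := 2) (μ := P) (c := Finsupp.linearCombination ℝ (meanPath b f θ) w),
    coeFn_linearCombination (fun t => (hε.memLp t).coeFn_toLp) w] with ω h1 h2 h3
  rw [observationL2, h1, Pi.add_apply, h2, linearCombination_response]
  exact congrArg _ h3

/-- The bridge between the seminorms in the definitions of integral and estimator and the Hilbert
space norm used in the proofs. -/
lemma eLpNorm_sub_linearCombination (hε : IsBrownianMotionOn P ε) (θ : Fin m → ℝ) {F : Ω → ℝ}
    {G : Lp ℝ 2 P} (hF : F =ᵐ[P] G) (w : Time b →₀ ℝ) :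
    eLpNorm (fun ω => F ω - Finsupp.linearCombination ℝ (response ε f θ ω) w) 2 P =
      ENNReal.ofReal ‖G - observationL2 hε f θ w‖ := by
  rw [Lp.norm_def, ENNReal.ofReal_toReal (Lp.eLpNorm_ne_top _)]
  refine eLpNorm_congr_ae ?_
  filter_upwards [hF, coeFn_observationL2 hε θ w, Lp.coeFn_sub G (observationL2 hε f θ w)]
    with ω h1 h2 h3
  rw [h3, Pi.sub_apply, h1, h2]

/-! ### The Wiener integral of `ḟ` and the integral against the response. -/

section WienerIntegral

variable (hb : 0 < b) (hf : ∀ i, ContDiffOn ℝ 1 (f i) (Icc 0 b))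

/-- The Itô isometry: both families have Gram matrix `min s t`, so the L² function `ḟ_i`, a limit of
step functions, has a counterpart in the noise space. -/
lemma exists_wienerIntegral (hb : 0 < b) (hf : ∀ i, ContDiffOn ℝ 1 (f i) (Icc 0 b))
    (hε : IsBrownianMotionOn P ε) (i : Fin m) :
    ∃ X : Lp ℝ 2 P, (∀ u, ‖X - Finsupp.linearCombination ℝ (noiseL2 hε) u‖ =
        ‖fdotL2 hb hf i - Finsupp.linearCombination ℝ initialIndicator u‖) ∧
      ∀ u, ⟪X, Finsupp.linearCombination ℝ (noiseL2 hε) u⟫_ℝ =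
        ⟪fdotL2 hb hf i, Finsupp.linearCombination ℝ initialIndicator u⟫_ℝ :=
  exists_transfer (fun s t => by rw [inner_initialIndicator, inner_noiseL2])
    (tendsto_linearCombination_uniformPartition hb (continuousOn_fdot hb hf i))

/-- The Wiener integral `∫ ḟ_i dε`. -/
noncomputable def wienerIntegral (hb : 0 < b) (hf : ∀ i, ContDiffOn ℝ 1 (f i) (Icc 0 b))
    (hε : IsBrownianMotionOn P ε) (i : Fin m) : Lp ℝ 2 P :=
  (exists_wienerIntegral hb hf hε i).choose

lemma norm_wienerIntegral_sub (hε : IsBrownianMotionOn P ε) (i : Fin m) (u : Time b →₀ ℝ) :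
    ‖wienerIntegral hb hf hε i - Finsupp.linearCombination ℝ (noiseL2 hε) u‖ =
      ‖fdotL2 hb hf i - Finsupp.linearCombination ℝ initialIndicator u‖ :=
  (exists_wienerIntegral hb hf hε i).choose_spec.1 u

lemma inner_linearCombination_fdotL2 (i : Fin m) (u : Time b →₀ ℝ) :
    ⟪Finsupp.linearCombination ℝ initialIndicator u, fdotL2 hb hf i⟫_ℝ =
      Finsupp.linearCombination ℝ (fun t : Time b => f i t - f i 0) u := by
  simp [Finsupp.linearCombination_apply, Finsupp.sum, sum_inner, real_inner_smul_left,
    inner_initialIndicator_fdotL2]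

lemma inner_linearCombination_wienerIntegral (hε : IsBrownianMotionOn P ε) (i : Fin m)
    (u : Time b →₀ ℝ) :
    ⟪Finsupp.linearCombination ℝ (noiseL2 hε) u, wienerIntegral hb hf hε i⟫_ℝ =
      Finsupp.linearCombination ℝ (fun t : Time b => f i t - f i 0) u := by
  rw [real_inner_comm, ← inner_linearCombination_fdotL2 hb hf, real_inner_comm (fdotL2 hb hf i)]
  exact (exists_wienerIntegral hb hf hε i).choose_spec.2 u

/-- The Riemann sum weights of `ḟ_i`. -/
noncomputable abbrev fdotWeights (b : ℝ) (f : Fin m → ℝ → ℝ) (i : Fin m) (n : ℕ)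
    (t : ℕ → Time b) : Time b →₀ ℝ :=
  partitionWeights (fun s => fdot b f i s) n t

lemma linearCombination_meanPath_fdotWeights (θ : Fin m → ℝ) (i : Fin m) (n : ℕ)
    (t : ℕ → Time b) :
    Finsupp.linearCombination ℝ (meanPath b f θ) (fdotWeights b f i n t) =
      ∑ j, θ j * ⟪Finsupp.linearCombination ℝ initialIndicator (fdotWeights b f i n t),
        fdotL2 hb hf j⟫_ℝ := by
  simp only [inner_linearCombination_fdotL2, ← leftSum_eq_linearCombination, leftSum, meanPath,
    Finset.mul_sum, ← Finset.sum_sub_distrib]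
  rw [Finset.sum_comm]
  refine Finset.sum_congr rfl fun j _ => Finset.sum_congr rfl fun k _ => ?_
  ring

/-- The error in the mean of a Riemann sum is linear in the step function error, so Cauchy–Schwarz
bounds it by the same quantity that controls the noise part. -/
lemma matM_mulVec_sub_linearCombination (θ : Fin m → ℝ) (i : Fin m) (n : ℕ) (t : ℕ → Time b) :
    (matM b f 0 *ᵥ θ) i -
        Finsupp.linearCombination ℝ (meanPath b f θ) (fdotWeights b f i n t) =
      ⟪fdotL2 hb hf i - Finsupp.linearCombination ℝ initialIndicator (fdotWeights b f i n t),
        ∑ j, θ j • fdotL2 hb hf j⟫_ℝ := by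
  rw [linearCombination_meanPath_fdotWeights hb hf, inner_sub_left, mulVec, dotProduct]
  simp only [inner_sum, real_inner_smul_right, inner_fdotL2, mul_comm]

/-- The square integrable version of `∫ ḟ_i dY` under the parameter `θ`. -/
noncomputable def responseIntegral (hε : IsBrownianMotionOn P ε) (θ : Fin m → ℝ) (i : Fin m) :
    Lp ℝ 2 P :=
  Lp.const 2 P ((matM b f 0 *ᵥ θ) i) + wienerIntegral hb hf hε i

lemma norm_responseIntegral_sub_le (hε : IsBrownianMotionOn P ε) (θ : Fin m → ℝ) (i : Fin m)
    (n : ℕ) (t : ℕ → Time b) :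
    ‖responseIntegral hb hf hε θ i - observationL2 hε f θ (fdotWeights b f i n t)‖ ≤
      (‖∑ j, θ j • fdotL2 hb hf j‖ + 1) *
        ‖fdotL2 hb hf i -
          Finsupp.linearCombination ℝ initialIndicator (fdotWeights b f i n t)‖ := by
  rw [responseIntegral, observationL2, add_sub_add_comm, ← map_sub,
    matM_mulVec_sub_linearCombination hb hf]
  refine (norm_add_le _ _).trans ?_
  rw [norm_const, norm_wienerIntegral_sub, add_mul, one_mul, mul_comm ‖∑ j, _‖]
  gcongr
  exact abs_real_inner_le_norm _ _

lemma isStochasticIntegral_of_ae_eq (hε : IsBrownianMotionOn P ε) (θ : Fin m → ℝ) (i : Fin m)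
    {F : Ω → ℝ} (hF : F =ᵐ[P] responseIntegral hb hf hε θ i) :
    IsStochasticIntegral P (fun t => fdot b f i t) (response ε f θ) F := by
  refine ⟨(memLp_congr_ae hF).2 (Lp.memLp _), fun η hη => ?_⟩
  set c := ‖∑ j, θ j • fdotL2 hb hf j‖ + 1
  have hc : 0 < c := by positivity
  obtain ⟨δ, hδ, h⟩ := exists_mesh_norm_sub_le (continuousOn_fdot hb hf i) (div_pos hη hc)
  refine ⟨δ, hδ, fun n t ht h0 hn hmesh => ?_⟩
  simp only [leftSum_eq_linearCombination]
  rw [eLpNorm_sub_linearCombination hε θ hF]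
  refine ENNReal.ofReal_le_ofReal ((norm_responseIntegral_sub_le hb hf hε θ i n t).trans ?_)
  have := h n t ht h0 hn hmesh
  rw [le_div_iff₀ hc] at this
  rw [mul_comm]
  exact this

include hb in
lemma IsStochasticIntegral.ae_eq (hε : IsBrownianMotionOn P ε) {θ : Fin m → ℝ} {g : Path b}
    {F F' : Ω → ℝ} (hF : IsStochasticIntegral P g (response ε f θ) F)
    (hF' : IsStochasticIntegral P g (response ε f θ) F') : F =ᵐ[P] F' := by
  have key : ∀ {G : Ω → ℝ} (hG : IsStochasticIntegral P g (response ε f θ) G),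
      Tendsto (fun N => observationL2 hε f θ
        (partitionWeights g (N + 1) (uniformPartition hb N))) atTop (𝓝 (hG.1.toLp G)) := by
    intro G hG
    rw [Metric.tendsto_atTop']
    intro η hη
    obtain ⟨δ, hδ, h⟩ := hG.2 (η / 2) (half_pos hη)
    obtain ⟨N₀, hN₀⟩ := eventually_atTop.1 (eventually_uniformPartition_mesh hb hδ)
    refine ⟨N₀, fun N hN => ?_⟩
    have := h _ _ (uniformPartition_monotone hb N) (uniformPartition_zero hb N)
      (by exact_mod_cast uniformPartition_last hb N) (hN₀ N hN.le)
    simp only [leftSum_eq_linearCombination] at this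
    rw [eLpNorm_sub_linearCombination hε θ hG.1.coeFn_toLp.symm,
      ENNReal.ofReal_le_ofReal_iff (half_pos hη).le] at this
    rw [dist_comm, dist_eq_norm]
    exact this.trans_lt (half_lt_self hη)
  have := tendsto_nhds_unique (key hF) (key hF')
  exact (MemLp.toLp_eq_toLp_iff _ _).1 this

lemma isIntegralFunctional_iff (hε : IsBrownianMotionOn P ε) {J : Path b → Fin m → ℝ} :
    IsIntegralFunctional P ε f J ↔ ∀ (θ : Fin m → ℝ) (i : Fin m),
      (fun ω => J (response ε f θ ω) i) =ᵐ[P] responseIntegral hb hf hε θ i :=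
  ⟨fun h θ i => (h θ i).ae_eq hb hε (isStochasticIntegral_of_ae_eq hb hf hε θ i .rfl),
    fun h θ i => isStochasticIntegral_of_ae_eq hb hf hε θ i (h θ i)⟩

lemma tendsto_wienerIntegral (hε : IsBrownianMotionOn P ε) (i : Fin m) :
    Tendsto (fun N => Finsupp.linearCombination ℝ (noiseL2 hε)
        (fdotWeights b f i (N + 1) (uniformPartition hb N))) atTop
      (𝓝 (wienerIntegral hb hf hε i)) := by
  have h := tendsto_linearCombination_uniformPartition hb (continuousOn_fdot hb hf i)
  rw [tendsto_iff_norm_sub_tendsto_zero] at h ⊢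
  simp only [norm_sub_rev _ (wienerIntegral hb hf hε i), norm_wienerIntegral_sub hb hf]
  refine h.congr fun N => ?_
  rw [norm_sub_rev]
  rfl

include hf in
lemma tendsto_linearCombination_meanPath (θ : Fin m → ℝ) (i : Fin m) :
    Tendsto (fun N => Finsupp.linearCombination ℝ (meanPath b f θ)
        (fdotWeights b f i (N + 1) (uniformPartition hb N))) atTop
      (𝓝 ((matM b f 0 *ᵥ θ) i)) := by
  have h := tendsto_linearCombination_uniformPartition hb (continuousOn_fdot hb hf i)
  have h2 := (tendsto_const_nhds (x := fdotL2 hb hf i)).sub h |>.inner (𝕜 := ℝ)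
    (tendsto_const_nhds (x := ∑ j, θ j • fdotL2 hb hf j))
  have h3 := (tendsto_const_nhds (x := (matM b f 0 *ᵥ θ) i)).sub h2
  simp only [← matM_mulVec_sub_linearCombination hb hf, sub_sub_cancel] at h3
  refine h3.trans_eq ?_
  rw [fdotL2, sub_self, inner_zero_left, sub_zero]

include hb hf in
-- Riemann sums of the noise converge almost surely along a subsequence, while their mean parts
-- converge for every θ. The subsequence depends on the noise alone, so the pathwise limit along it
-- is one functional serving all θ.
lemma exists_isIntegralFunctional (hε : IsBrownianMotionOn P ε) :
    ∃ J, IsIntegralFunctional P ε f J := by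
  have hsub : ∀ i : Fin m, ∃ ns : ℕ → ℕ, StrictMono ns ∧ ∀ᵐ ω ∂P,
      Tendsto (fun k => (Finsupp.linearCombination ℝ (noiseL2 hε)
        (fdotWeights b f i (ns k + 1) (uniformPartition hb (ns k))) : Lp ℝ 2 P) ω) atTop
        (𝓝 (wienerIntegral hb hf hε i ω)) := fun i =>
    (tendstoInMeasure_of_tendsto_Lp (tendsto_wienerIntegral hb hf hε i)).exists_seq_tendsto_ae
  choose ns hns hlim using hsub
  refine ⟨fun z i => limUnder atTop fun k => Finsupp.linearCombination ℝ z
    (fdotWeights b f i (ns i k + 1) (uniformPartition hb (ns i k))), ?_⟩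
  refine (isIntegralFunctional_iff hb hf hε).2 fun θ i => ?_
  have hae : ∀ᵐ ω ∂P, ∀ k, (Finsupp.linearCombination ℝ (noiseL2 hε)
      (fdotWeights b f i (ns i k + 1) (uniformPartition hb (ns i k))) : Lp ℝ 2 P) ω =
      Finsupp.linearCombination ℝ (fun t => ε t ω)
        (fdotWeights b f i (ns i k + 1) (uniformPartition hb (ns i k))) :=
    ae_all_iff.2 fun k => coeFn_linearCombination (fun t => (hε.memLp t).coeFn_toLp) _
  filter_upwards [hlim i, hae, Lp.coeFn_add (Lp.const 2 P ((matM b f 0 *ᵥ θ) i))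
      (wienerIntegral hb hf hε i),
    Lp.coeFn_const (p := 2) (μ := P) (c := (matM b f 0 *ᵥ θ) i)] with ω h1 h2 h3 h4
  rw [responseIntegral, h3, Pi.add_apply, h4]
  refine Tendsto.limUnder_eq ?_
  simp only [linearCombination_response, ← h2]
  exact ((tendsto_linearCombination_meanPath hb hf θ i).comp (hns i).tendsto_atTop).add h1

end WienerIntegral

end Response

/-! ### Linear unbiased estimators and their errors. -/

section Estimator

variable {Ω : Type*} [MeasurableSpace Ω] {P : Measure Ω} [IsProbabilityMeasure P]
  {b : ℝ} {ε : Time b → Ω → ℝ} {m : ℕ} {f : Fin m → ℝ → ℝ}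

lemma finsupp_sum_smul_apply {ι : Type*} (z : ι → ℝ) (L : ι →₀ (Fin m → ℝ)) (i : Fin m) :
    (L.sum fun t w => z t • w) i =
      Finsupp.linearCombination ℝ z (L.mapRange (fun w => w i) rfl) := by
  rw [Finsupp.linearCombination_apply, Finsupp.sum_mapRange_index (by simp), Finsupp.sum,
    Finset.sum_apply, Finsupp.sum]
  simp [mul_comm]

lemma exists_finsupp_sum_smul_apply {ι : Type*} (w : Fin m → ι →₀ ℝ) :
    ∃ L : ι →₀ (Fin m → ℝ), ∀ (z : ι → ℝ) (i : Fin m),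
      (L.sum fun t w => z t • w) i = Finsupp.linearCombination ℝ z (w i) := by
  classical
  refine ⟨∑ j, (w j).mapRange (Pi.single j) (Pi.single_zero j), fun z i => ?_⟩
  rw [finsupp_sum_smul_apply]
  congr 1
  ext t
  simp [Finsupp.finsetSum_apply, Finset.sum_apply, Pi.single_apply]

/-- The estimation error `T - θ` under the parameter `θ`, as square integrable variables. -/
noncomputable def errorL2 {T : Path b → Fin m → ℝ} {θ : Fin m → ℝ}
    (hT : ∀ i, MemLp (fun ω => T (response ε f θ ω) i) 2 P) (i : Fin m) : Lp ℝ 2 P :=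
  (hT i).toLp _ - Lp.const 2 P (θ i)

lemma coeFn_errorL2 {T : Path b → Fin m → ℝ} {θ : Fin m → ℝ}
    (hT : ∀ i, MemLp (fun ω => T (response ε f θ ω) i) 2 P) (i : Fin m) :
    errorL2 hT i =ᵐ[P] fun ω => T (response ε f θ ω) i - θ i := by
  filter_upwards [Lp.coeFn_sub ((hT i).toLp _) (Lp.const 2 P (θ i)), (hT i).coeFn_toLp,
    Lp.coeFn_const (p := 2) (μ := P) (c := θ i)] with ω h1 h2 h3
  rw [errorL2, h1, Pi.sub_apply, h2, h3, Function.const_apply]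

lemma covMat_eq_gram {T : Path b → Fin m → ℝ} {θ : Fin m → ℝ}
    (hT : ∀ i, MemLp (fun ω => T (response ε f θ ω) i) 2 P) (hu : IsUnbiased P ε f T) :
    covMat P ε f T θ = Matrix.gram ℝ (errorL2 hT) := by
  ext i j
  rw [covMat, of_apply, Matrix.gram_apply, covariance, L2.inner_def]
  refine integral_congr_ae ?_
  filter_upwards [coeFn_errorL2 hT i, coeFn_errorL2 hT j] with ω h1 h2
  simp [h1, h2, hu θ i, hu θ j, mul_comm]

/-- A linear unbiased estimator is approximated by finite linear combinations whose means converge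
to the parameter and whose noise parts converge to the estimation error. -/
lemma IsLinearEstimator.exists_weights (hε : IsBrownianMotionOn P ε) {T : Path b → Fin m → ℝ}
    (hT : IsLinearEstimator P ε f T) (hu : IsUnbiased P ε f T) :
    ∃ w : ℕ → Fin m → Time b →₀ ℝ, ∀ θ i,
      Tendsto (fun n => Finsupp.linearCombination ℝ (meanPath b f θ) (w n i)) atTop (𝓝 (θ i)) ∧
      Tendsto (fun n => Finsupp.linearCombination ℝ (noiseL2 hε) (w n i)) atTop
        (𝓝 (errorL2 (hT.1 θ) i)) := by
  obtain ⟨L, hL⟩ := hT.2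
  refine ⟨fun n i => (L n).mapRange (fun w => w i) rfl, fun θ i => ?_⟩
  have h1 : Tendsto (fun n => observationL2 hε f θ ((L n).mapRange (fun w => w i) rfl)) atTop
      (𝓝 ((hT.1 θ i).toLp _)) := by
    have := hL θ i
    simp only [finsupp_sum_smul_apply] at this
    simp only [eLpNorm_sub_linearCombination hε θ (hT.1 θ i).coeFn_toLp.symm] at this
    rw [tendsto_iff_norm_sub_tendsto_zero]
    have h := (ENNReal.tendsto_toReal ENNReal.zero_ne_top).comp this
    simpa [Function.comp_def, norm_sub_rev] using h
  have h2 : Tendsto (fun n => Finsupp.linearCombination ℝ (meanPath b f θ)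
      ((L n).mapRange (fun w => w i) rfl)) atTop (𝓝 (θ i)) := by
    -- Taking expectations isolates the mean parts, since the noise is centered.
    have h := (tendsto_const_nhds (x := Lp.const 2 P (1 : ℝ))).inner (𝕜 := ℝ) h1
    rw [inner_const_one, integral_congr_ae (hT.1 θ i).coeFn_toLp, hu θ i] at h
    simpa only [observationL2, inner_add_right, inner_const_one_const, inner_const_one_noiseL2,
      add_zero] using h
  refine ⟨h2, ?_⟩
  simpa only [errorL2, observationL2, add_sub_cancel_left] using h1.sub (tendsto_const (P := P) h2)

/-! ### Optimality and uniqueness of `thetaHat`. -/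

section BLUE

variable (hb : 0 < b) (hf : ∀ i, ContDiffOn ℝ 1 (f i) (Icc 0 b))

/-- The estimation error of the estimator `thetaHat`. -/
noncomputable def blueError (hε : IsBrownianMotionOn P ε) (j : Fin m) : Lp ℝ 2 P :=
  ∑ k, lowerC b f j k • wienerIntegral hb hf hε k

/-- The covariance of `thetaHat` with any linear unbiased estimator is the same. -/
lemma inner_errorL2_blueError (hε : IsBrownianMotionOn P ε) (hq : quad0 b f ≠ 0)
    {T : Path b → Fin m → ℝ} (hT : IsLinearEstimator P ε f T) (hu : IsUnbiased P ε f T)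
    (θ : Fin m → ℝ) (i j : Fin m) :
    ⟪errorL2 (hT.1 θ) i, blueError hb hf hε j⟫_ℝ = lowerC b f j i := by
  obtain ⟨w, hw⟩ := hT.exists_weights hε hu
  refine tendsto_nhds_unique ((hw θ i).2.inner (𝕜 := ℝ) tendsto_const_nhds) ?_
  -- Unbiasedness is used at row j of `lowerC` as parameter, while the error is taken under θ; the
  -- weights are common to both.
  refine (hw (fun k => lowerC b f j k) i).1.congr fun n => ?_
  have h0 : ∑ k, lowerC b f j k * f k 0 = 0 := congrFun (lowerC_mulVec_fvec hq) j
  have hmean : meanPath b f (fun k => lowerC b f j k) =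
      fun t : Time b => ∑ k, lowerC b f j k * (f k t - f k 0) := by
    ext t
    simp [meanPath, mul_sub, h0]
  rw [blueError, inner_sum, hmean]
  simp only [real_inner_smul_right, inner_linearCombination_wienerIntegral]
  simp only [Finsupp.linearCombination_apply, Finsupp.sum, smul_eq_mul, Finset.mul_sum]
  rw [Finset.sum_comm]
  refine Finset.sum_congr rfl fun k _ => Finset.sum_congr rfl fun t _ => ?_
  ring

lemma noiseL2_time0 (hε : IsBrownianMotionOn P ε) : noiseL2 hε (time0 hb) = 0 := by
  rw [← inner_self_eq_zero (𝕜 := ℝ), inner_noiseL2]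
  simp [time0]

/-- The weight of the observation at time `0` in `thetaHat`. -/
noncomputable abbrev startWeight (b : ℝ) (f : Fin m → ℝ → ℝ) : Fin m → ℝ :=
  (quad0 b f)⁻¹ • ((matM b f 0)⁻¹ *ᵥ fvec f 0)

lemma lowerC_mulVec_add_startWeight (hM : IsUnit (matM b f 0)) (θ : Fin m → ℝ) (j : Fin m) :
    ∑ k, lowerC b f j k * (matM b f 0 *ᵥ θ) k + startWeight b f j * (∑ i, θ i * f i 0) = θ j := by
  rw [mul_comm (startWeight b f j)]
  exact congrFun (lowerC_mulVec_matM_mulVec_add hM θ) j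

/-- The noise at time 0 has variance 0, so `Y_0` is θᵀf(0) almost surely. The deterministic parts
then add up to θ and only the Wiener integrals remain. -/
lemma thetaHat_ae_eq (hε : IsBrownianMotionOn P ε) (hM : IsUnit (matM b f 0))
    {J : Path b → Fin m → ℝ} (hJ : IsIntegralFunctional P ε f J) (θ : Fin m → ℝ) (j : Fin m) :
    (fun ω => thetaHat hb f J (response ε f θ ω) j) =ᵐ[P]
      (Lp.const 2 P (θ j) + blueError hb hf hε j : Lp ℝ 2 P) := by
  rw [isIntegralFunctional_iff hb hf hε] at hJ
  have h0 : ε (time0 hb) =ᵐ[P] 0 := by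
    have h := (hε.memLp (time0 hb)).coeFn_toLp
    change noiseL2 hε (time0 hb) =ᵐ[P] _ at h
    rw [noiseL2_time0] at h
    exact h.symm.trans (Lp.coeFn_zero ℝ 2 P)
  have hX : ∀ᵐ ω ∂P, ∀ k, J (response ε f θ ω) k =
      (matM b f 0 *ᵥ θ) k + wienerIntegral hb hf hε k ω := by
    refine ae_all_iff.2 fun k => ?_
    filter_upwards [hJ θ k, Lp.coeFn_add (Lp.const 2 P ((matM b f 0 *ᵥ θ) k))
      (wienerIntegral hb hf hε k),
      Lp.coeFn_const (p := 2) (μ := P) (c := (matM b f 0 *ᵥ θ) k)] with ω h1 h2 h3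
    rw [h1, responseIntegral, h2, Pi.add_apply, h3, Function.const_apply]
  have hZ : blueError hb hf hε j =ᵐ[P]
      fun ω => ∑ k, lowerC b f j k * wienerIntegral hb hf hε k ω := by
    have h := coeFn_linearCombination (μ := P) (v := wienerIntegral hb hf hε)
      (F := fun k => wienerIntegral hb hf hε k) (fun _ => .rfl)
      (Finsupp.equivFunOnFinite.symm fun k => lowerC b f j k)
    simp only [Finsupp.linearCombination_apply] at h
    simpa only [Finsupp.sum_fintype, zero_smul, zero_mul, implies_true, smul_eq_mul,
      Finsupp.equivFunOnFinite_symm_apply_apply, ← blueError.eq_1] using h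
  filter_upwards [h0, hX, hZ, Lp.coeFn_add (Lp.const 2 P (θ j)) (blueError hb hf hε j),
    Lp.coeFn_const (p := 2) (μ := P) (c := θ j)] with ω h1 h2 h3 h4 h5
  rw [h4, Pi.add_apply, h5, h3, Function.const_apply, ← lowerC_mulVec_add_startWeight hM θ j]
  have h6 : response ε f θ ω (time0 hb) = ∑ i, θ i * f i 0 := by
    rw [response, h1]
    simp [time0]
  simp only [thetaHat, Pi.add_apply, Pi.smul_apply, h6, mulVec, dotProduct, h2, mul_add,
    Finset.sum_add_distrib, smul_eq_mul]
  ring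

include hf in
lemma thetaHat_isLinearEstimator (hε : IsBrownianMotionOn P ε) (hM : IsUnit (matM b f 0))
    {J : Path b → Fin m → ℝ} (hJ : IsIntegralFunctional P ε f J) :
    IsLinearEstimator P ε f (thetaHat hb f J) := by
  have hae := thetaHat_ae_eq hb hf hε hM hJ
  refine ⟨fun θ i => (memLp_congr_ae (hae θ i)).2 (Lp.memLp _), ?_⟩
  -- The approximating weights are the Riemann weights of the `ḟ_k` mixed by `lowerC`, plus a point
  -- mass at time 0.
  choose L hL using fun N : ℕ => exists_finsupp_sum_smul_apply fun j : Fin m =>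
    ∑ k, lowerC b f j k • fdotWeights b f k (N + 1) (uniformPartition hb N) +
      startWeight b f j • Finsupp.single (time0 hb) (1 : ℝ)
  refine ⟨L, fun θ j => ?_⟩
  simp only [hL, eLpNorm_sub_linearCombination hε θ (hae θ j)]
  rw [← ENNReal.ofReal_zero]
  refine ENNReal.tendsto_ofReal ?_
  simp only [norm_sub_rev (_ + _ : Lp ℝ 2 P)]
  rw [← tendsto_iff_norm_sub_tendsto_zero]
  refine Tendsto.add (tendsto_const ?_) ?_
  · rw [← lowerC_mulVec_add_startWeight hM θ j]
    simp only [map_add, map_sum, map_smul, Finsupp.linearCombination_single, smul_eq_mul,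
      one_mul]
    exact (tendsto_finsetSum _ fun k _ =>
      (tendsto_linearCombination_meanPath hb hf θ k).const_mul _).add
      (tendsto_const_nhds (x := startWeight b f j * ∑ i, θ i * f i 0))
  · simp only [map_add, map_sum, map_smul, Finsupp.linearCombination_single, noiseL2_time0,
      smul_zero, add_zero]
    exact tendsto_finsetSum _ fun k _ => (tendsto_wienerIntegral hb hf hε k).const_smul _

include hf in
lemma integral_blueError (hε : IsBrownianMotionOn P ε) (j : Fin m) :
    ∫ ω, blueError hb hf hε j ω ∂P = 0 := by
  have h : ∀ k, ⟪Lp.const 2 P (1 : ℝ), wienerIntegral hb hf hε k⟫_ℝ = 0 := fun k => by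
    refine tendsto_nhds_unique ((tendsto_const_nhds (x := Lp.const 2 P (1 : ℝ))).inner (𝕜 := ℝ)
      (tendsto_wienerIntegral hb hf hε k)) ?_
    simp only [inner_const_one_noiseL2]
    exact tendsto_const_nhds
  rw [← inner_const_one, blueError, inner_sum]
  simp [real_inner_smul_right, h]

include hf in
lemma thetaHat_isUnbiased (hε : IsBrownianMotionOn P ε) (hM : IsUnit (matM b f 0))
    {J : Path b → Fin m → ℝ} (hJ : IsIntegralFunctional P ε f J) :
    IsUnbiased P ε f (thetaHat hb f J) := by
  intro θ j
  rw [integral_congr_ae (thetaHat_ae_eq hb hf hε hM hJ θ j), ← inner_const_one, inner_add_right,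
    inner_const_one_const, inner_const_one, integral_blueError, add_zero]

lemma errorL2_thetaHat (hε : IsBrownianMotionOn P ε) (hM : IsUnit (matM b f 0))
    {J : Path b → Fin m → ℝ} (hJ : IsIntegralFunctional P ε f J) (θ : Fin m → ℝ) (j : Fin m) :
    errorL2 ((thetaHat_isLinearEstimator hb hf hε hM hJ).1 θ) j = blueError hb hf hε j := by
  rw [errorL2, sub_eq_iff_eq_add']
  refine Lp.ext ((MemLp.coeFn_toLp _).trans (thetaHat_ae_eq hb hf hε hM hJ θ j))

include hf in
-- `thetaHat` is itself linear and unbiased, so the covariance identity applies to it, and no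
-- product of `lowerC` with `M_0` needs computing. The parameter 0 is an arbitrary choice.
lemma inner_blueError (hε : IsBrownianMotionOn P ε) (hM : IsUnit (matM b f 0))
    (hq : quad0 b f ≠ 0) (i j : Fin m) :
    ⟪blueError hb hf hε i, blueError hb hf hε j⟫_ℝ = lowerC b f i j := by
  obtain ⟨J, hJ⟩ := exists_isIntegralFunctional hb hf hε
  rw [real_inner_comm, ← errorL2_thetaHat hb hf hε hM hJ 0 j]
  exact inner_errorL2_blueError hb hf hε hq (thetaHat_isLinearEstimator hb hf hε hM hJ)
    (thetaHat_isUnbiased hb hf hε hM hJ) 0 j i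

include hf in
lemma covMat_thetaHat (hε : IsBrownianMotionOn P ε) (hM : IsUnit (matM b f 0))
    (hq : quad0 b f ≠ 0) {J : Path b → Fin m → ℝ} (hJ : IsIntegralFunctional P ε f J)
    (θ : Fin m → ℝ) : covMat P ε f (thetaHat hb f J) θ = lowerC b f := by
  rw [covMat_eq_gram ((thetaHat_isLinearEstimator hb hf hε hM hJ).1 θ)
    (thetaHat_isUnbiased hb hf hε hM hJ)]
  ext i j
  rw [Matrix.gram_apply, errorL2_thetaHat hb hf hε hM hJ,
    errorL2_thetaHat hb hf hε hM hJ, inner_blueError hb hf hε hM hq]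

/-- The excess covariance of a linear unbiased estimator over `thetaHat` is a Gram matrix. -/
lemma covMat_sub_lowerC (hε : IsBrownianMotionOn P ε) (hM : IsUnit (matM b f 0))
    (hq : quad0 b f ≠ 0) {T : Path b → Fin m → ℝ} (hT : IsLinearEstimator P ε f T)
    (hu : IsUnbiased P ε f T) (θ : Fin m → ℝ) :
    covMat P ε f T θ - lowerC b f =
      Matrix.gram ℝ fun i => errorL2 (hT.1 θ) i - blueError hb hf hε i := by
  ext i j
  have h1 := inner_errorL2_blueError hb hf hε hq hT hu θ i j
  have h2 := inner_errorL2_blueError hb hf hε hq hT hu θ j i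
  have h3 := inner_blueError hb hf hε hM hq i j
  -- Together with `h3` this gives the symmetry of `lowerC`, which the final cancellation needs.
  have h4 := inner_blueError hb hf hε hM hq j i
  rw [real_inner_comm] at h2 h4
  rw [covMat_eq_gram (hT.1 θ) hu, Matrix.sub_apply, Matrix.gram_apply, Matrix.gram_apply,
    inner_sub_left, inner_sub_right, inner_sub_right]
  linarith

include hf in
lemma thetaHat_isBLUE (hε : IsBrownianMotionOn P ε) (hM : IsUnit (matM b f 0))
    (hq : quad0 b f ≠ 0) {J : Path b → Fin m → ℝ} (hJ : IsIntegralFunctional P ε f J) :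
    IsBLUE P ε f (thetaHat hb f J) where
  linear := thetaHat_isLinearEstimator hb hf hε hM hJ
  unbiased := thetaHat_isUnbiased hb hf hε hM hJ
  best S hS hu θ := by
    rw [covMat_thetaHat hb hf hε hM hq hJ, covMat_sub_lowerC hb hf hε hM hq hS hu]
    exact Matrix.posSemidef_gram ℝ _

include hf in
-- Minimality of T against `thetaHat` makes the negative of a Gram matrix positive semidefinite; its
-- diagonal entries, minus squared norms of error differences, must therefore vanish.
lemma IsBLUE.ae_eq_thetaHat (hε : IsBrownianMotionOn P ε) (hM : IsUnit (matM b f 0))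
    (hq : quad0 b f ≠ 0) {J : Path b → Fin m → ℝ} (hJ : IsIntegralFunctional P ε f J)
    {T : Path b → Fin m → ℝ} (hT : IsBLUE P ε f T) (θ : Fin m → ℝ) :
    ∀ᵐ ω ∂P, T (response ε f θ ω) = thetaHat hb f J (response ε f θ ω) := by
  have hle := hT.best _ (thetaHat_isLinearEstimator hb hf hε hM hJ)
    (thetaHat_isUnbiased hb hf hε hM hJ) θ
  rw [covMat_thetaHat hb hf hε hM hq hJ, ← neg_sub,
    covMat_sub_lowerC hb hf hε hM hq hT.linear hT.unbiased] at hle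
  have herr : ∀ i, errorL2 (hT.linear.1 θ) i = blueError hb hf hε i := fun i => by
    have h := hle.diag_nonneg (i := i)
    rw [Matrix.neg_apply, Matrix.gram_apply, real_inner_self_eq_norm_sq] at h
    have h' : ‖errorL2 (hT.linear.1 θ) i - blueError hb hf hε i‖ = 0 :=
      pow_eq_zero_iff two_ne_zero |>.1 (le_antisymm (by linarith) (sq_nonneg _))
    exact sub_eq_zero.1 (norm_eq_zero.1 h')
  have hae : ∀ᵐ ω ∂P, ∀ i, T (response ε f θ ω) i = thetaHat hb f J (response ε f θ ω) i := by
    refine ae_all_iff.2 fun i => ?_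
    have h1 := coeFn_errorL2 (hT.linear.1 θ) i
    have h2 := coeFn_errorL2 ((thetaHat_isLinearEstimator hb hf hε hM hJ).1 θ) i
    rw [herr] at h1
    rw [errorL2_thetaHat hb hf hε hM hJ] at h2
    filter_upwards [h1, h2] with ω h3 h4
    linarith
  exact hae.mono fun ω h => funext h

end BLUE

end Estimator

end ContinuousRegression

theorem mainTheorem4 {Ω : Type*} [MeasurableSpace Ω] (P : Measure Ω) [IsProbabilityMeasure P]
    {b : ℝ} (hb : 0 < b)
    (ε : ContinuousRegression.Time b → Ω → ℝ)
    (hε : ContinuousRegression.IsBrownianMotionOn P ε)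
    {m : ℕ} (f : Fin m → ℝ → ℝ)
    (hf : ∀ i, ContDiffOn ℝ 1 (f i) (Set.Icc 0 b))
    (hbv : ∀ i, BoundedVariationOn (f i) (Set.Icc 0 b))
    (hli : LinearIndependent ℝ fun i => fun t : Set.Icc (0 : ℝ) b => f i t)
    (hone : (fun _ : Set.Icc (0 : ℝ) b => (1 : ℝ)) ∉
      Submodule.span ℝ (Set.range fun i => fun t : Set.Icc (0 : ℝ) b => f i t))
    (hf0 : ContinuousRegression.fvec f 0 ≠ 0) :
    -- the inverses and the denominator in the formulas make sense
    IsUnit (ContinuousRegression.matM b f 0) ∧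
    0 < ContinuousRegression.quad0 b f ∧
    (∀ᶠ a in 𝓝[>] (0 : ℝ), IsUnit (ContinuousRegression.matC b f a)) ∧
    -- the matrix is the limit of the inverses of `C_a`
    Tendsto (fun a => (ContinuousRegression.matC b f a)⁻¹) (𝓝[>] (0 : ℝ))
      (𝓝 (ContinuousRegression.lowerC b f)) ∧
    -- the stochastic integral exists, and the estimator built from it is the BLUE,
    -- which is almost surely unique, with the stated covariance matrix
    (∃ J, ContinuousRegression.IsIntegralFunctional P ε f J) ∧
    ∀ J, ContinuousRegression.IsIntegralFunctional P ε f J →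
      ContinuousRegression.IsBLUE P ε f (ContinuousRegression.thetaHat hb f J) ∧
      (∀ T, ContinuousRegression.IsBLUE P ε f T → ∀ θ, ∀ᵐ ω ∂P,
        T (ContinuousRegression.response ε f θ ω) =
          ContinuousRegression.thetaHat hb f J (ContinuousRegression.response ε f θ ω)) ∧
      (∀ θ, ContinuousRegression.covMat P ε f (ContinuousRegression.thetaHat hb f J) θ =
        ContinuousRegression.lowerC b f) := by
  have hMp := ContinuousRegression.posDef_matM hb hf hli hone
  have hM := hMp.isUnit
  have hq := ContinuousRegression.quad0_pos hMp hf0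
  obtain ⟨hC, hlim⟩ := ContinuousRegression.isUnit_matC_and_tendsto_inv hb hf hM hq
  exact ⟨hM, hq, hC, hlim, ContinuousRegression.exists_isIntegralFunctional hb hf hε,
    fun J hJ => ⟨ContinuousRegression.thetaHat_isBLUE hb hf hε hM hq.ne' hJ,
      fun T hT θ => hT.ae_eq_thetaHat hb hf hε hM hq.ne' hJ θ,
      fun θ => ContinuousRegression.covMat_thetaHat hb hf hε hM hq.ne' hJ θ⟩⟩
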